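/- **Setting.** Let $A\in\mathbb{R}^{M\times N}$, let $s\in\mathbb{R}^N$ be $K$-sparse (at most $K$ nonzero entries) with support $S$, let $e\in\mathbb{R}^M$ and $\tilde y=As+e$. For a nonnegative integer $k$, let $\delta_k$ be the smallest $\delta\ge 0$ such that $(1-\delta)\|x\|_2^2\le\|Ax\|_2^2\le(1+\delta)\|x\|_2^2$ for all $k$-sparse $x$. For a vector $u$, let $u_k$ denote a best $k$-term approximation of $u$ in $\|\cdot\|_2$ (ties broken arbitrarily); for an index set $T$, $s_T$ is the subvector of $s$ and $A_T$ the column submatrix of $A$ indexed by $T$, and $A_T^\dagger$ is the Moore–Penrose inverse. Write $\mathrm{LS}(T)$ for the vector $b\in\mathbb{R}^N$ with $b_T=A_T^\dagger\tilde y$ and $b_{T^c}=0$. The algorithms are, for $l\ge 1$: * **CoSaMP:** $s^{[0]}=0$; $u=A^{\mathrm T}(\tilde y-As^{[l-1]})$, $\Omega=\mathrm{supp}(u_{2K})$, $b=\mathrm{LS}(\Omega\cup\mathrm{supp}(s^{[l-1]}))$, $s^{[l]}=b_K$. * **SP:** $S^0=\mathrm{supp}((A^{\mathrm T}\tilde y)_K)$,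 $s^{[0]}=\mathrm{LS}(S^0)$; $u=A^{\mathrm T}(\tilde y-As^{[l-1]})$, $\Omega=\mathrm{supp}(u_K)$, $p=\mathrm{LS}(\Omega\cup S^{l-1})$, $S^l=\mathrm{supp}(p_K)$, $s^{[l]}=\mathrm{LS}(S^l)$. * **IHT:** $s^{[0]}=0$; $s^{[l]}=\big(s^{[l-1]}+A^{\mathrm T}(\tilde y-As^{[l-1]})\big)_K$. The constants are, with $\delta=\delta_{bK}$: * **CoSaMP:** $a=1$, $b=4$, $c=0.171$, $C=\frac{4\delta}{(1-\delta)^2}$, $C_1=\frac{6+2\delta}{(1-\delta)^2}$, $D=\frac{6+2\delta}{1-6\delta+\delta^2}$. * **SP:** $a=1.26$, $b=3$, $c=0.206$, $C=\frac{2\delta+2\delta^2}{(1-\delta)^3}$, $C_1=\frac{4(1+\delta)}{(1-\delta)^2}$, $D=\frac{5-4\delta-8\delta^2-\delta^4}{1-6\delta+6\delta^2-2\delta^3+\delta^4}$. * **IHT:** $a=1$, $b=3$, $c=0.353$, $C=\sqrt8\,\delta$, $C_1=2\sqrt{1+\delta}$, $D=\frac{2\sqrt{1+\delta}}{1-\sqrt8\,\delta}$.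 **Theorem.** (i) For all $l\ge1$, the iterates of CoSaMP (if $\delta_{4K}<1$) and of IHT (with no condition on $\delta_{3K}$) satisfy $$\|s-s^{[l]}\|_2\le C\,\|s-s^{[l-1]}\|_2+C_1\|e\|_2,$$ and the support estimates of SP (if $\delta_{3K}<1$) satisfy $$\|s_{S\setminus S^l}\|_2\le C\,\|s_{S\setminus S^{l-1}}\|_2+C_1\|e\|_2.$$ (ii) For each of the three algorithms, if $\delta_{bK}\le c$, then $C<1$ and, for all $l\ge0$, $$\|s-s^{[l]}\|_2\le a\,C^l\|s\|_2+D\|e\|_2.$$ -/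

import Mathlib

open Matrix

namespace GreedyPursuit

/-- The Euclidean norm `‖x‖₂` of a real vector. -/
noncomputable def l2norm {ι : Type*} [Fintype ι] (x : ι → ℝ) : ℝ := ‖WithLp.toLp 2 x‖

/-- The support of a vector: the set of the locations of its nonzero entries. -/
noncomputable def supp {N : ℕ} (x : Fin N → ℝ) : Finset (Fin N) :=
  Finset.univ.filter fun i => x i ≠ 0

/-- `x` is `K`-sparse: at most `K` of its entries are nonzero. -/
def IsSparse {N : ℕ} (K : ℕ) (x : Fin N → ℝ) : Prop := (supp x).card ≤ K

/-- The subvector `x_S` composed of the entries of `x` indexed by the set `S`. -/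
def subvec {N : ℕ} (S : Finset (Fin N)) (x : Fin N → ℝ) : S → ℝ := fun i => x i

/-- The submatrix `A_S` composed of the columns of `A` indexed by the set `S`. -/
def colSub {M N : ℕ} (A : Matrix (Fin M) (Fin N) ℝ) (S : Finset (Fin N)) :
    Matrix (Fin M) S ℝ := A.submatrix id Subtype.val

/-- `v` is a best `K`-term approximation `u_K` of `u`. It need not be unique: entries of equal
magnitude may be chosen among arbitrarily. -/
def IsBestApprox {N : ℕ} (K : ℕ) (u v : Fin N → ℝ) : Prop :=
  IsSparse K v ∧ ∀ w : Fin N → ℝ, IsSparse K w → l2norm (u - v) ≤ l2norm (u - w)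

/-- The nonnegative numbers `δ` with `(1 - δ) ‖x‖² ≤ ‖A x‖² ≤ (1 + δ) ‖x‖²` for all `K`-sparse
vectors `x`. -/
def ripSet {M N : ℕ} (A : Matrix (Fin M) (Fin N) ℝ) (K : ℕ) : Set ℝ :=
  {δ | 0 ≤ δ ∧ ∀ x : Fin N → ℝ, IsSparse K x →
    (1 - δ) * l2norm x ^ 2 ≤ l2norm (A *ᵥ x) ^ 2 ∧
      l2norm (A *ᵥ x) ^ 2 ≤ (1 + δ) * l2norm x ^ 2}

/-- The restricted isometry constant `δ_K` of `A`. -/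
noncomputable def ric {M N : ℕ} (A : Matrix (Fin M) (Fin N) ℝ) (K : ℕ) : ℝ := sInf (ripSet A K)

/-- The infimum in the definition of `ric` is attained: it is the smallest admissible number. -/
theorem ric_isLeast {M N : ℕ} (A : Matrix (Fin M) (Fin N) ℝ) (K : ℕ) :
    IsLeast (ripSet A K) (ric A K) := by
  have hb : BddBelow (ripSet A K) := ⟨0, fun δ h => h.1⟩
  refine ⟨IsClosed.csInf_mem ?_ ?_ hb, fun δ h => csInf_le hb h⟩
  · have : ripSet A K = {δ : ℝ | 0 ≤ δ} ∩ ⋂ x : Fin N → ℝ, ⋂ _ : IsSparse K x,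
        ({δ : ℝ | (1 - δ) * l2norm x ^ 2 ≤ l2norm (A *ᵥ x) ^ 2} ∩
          {δ : ℝ | l2norm (A *ᵥ x) ^ 2 ≤ (1 + δ) * l2norm x ^ 2}) := by
      ext δ
      simp [ripSet]
    rw [this]
    refine (isClosed_le continuous_const continuous_id).inter
      (isClosed_iInter fun x => isClosed_iInter fun _ => ?_)
    exact (isClosed_le (by fun_prop) (by fun_prop)).inter
      (isClosed_le (by fun_prop) (by fun_prop))
  · let L : EuclideanSpace ℝ (Fin N) →L[ℝ] EuclideanSpace ℝ (Fin M) :=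
      LinearMap.toContinuousLinearMap
        ((WithLp.linearEquiv 2 ℝ (Fin M → ℝ)).symm.toLinearMap ∘ₗ A.mulVecLin ∘ₗ
          (WithLp.linearEquiv 2 ℝ (Fin N → ℝ)).toLinearMap)
    have hL : ∀ x : Fin N → ℝ, l2norm (A *ᵥ x) ≤ ‖L‖ * l2norm x := fun x =>
      L.le_opNorm (WithLp.toLp 2 x)
    refine ⟨1 + ‖L‖ ^ 2, by positivity, fun x _ => ?_⟩
    have h0 : 0 ≤ l2norm (A *ᵥ x) := norm_nonneg _
    have h1 : l2norm (A *ᵥ x) ^ 2 ≤ (‖L‖ * l2norm x) ^ 2 := pow_le_pow_left₀ h0 (hL x) 2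
    rw [mul_pow] at h1
    constructor <;> nlinarith [sq_nonneg (l2norm x), sq_nonneg (l2norm (A *ᵥ x)),
      mul_nonneg (sq_nonneg ‖L‖) (sq_nonneg (l2norm x))]

/-- `P` is a Moore-Penrose inverse of `B` (the four Penrose equations). -/
structure IsMoorePenrose {m n : Type*} [Fintype m] [Fintype n] (B : Matrix m n ℝ)
    (P : Matrix n m ℝ) : Prop where
  mul_mul_left : B * P * B = B
  mul_mul_right : P * B * P = P
  symm_left : (B * P)ᵀ = B * P
  symm_right : (P * B)ᵀ = P * B

theorem exists_isMoorePenrose {m n : Type*} [Fintype m] [Fintype n]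
    (B : Matrix m n ℝ) : ∃ P, IsMoorePenrose B P := by
  classical
  have hH : (Bᵀ * B).IsHermitian := by
    simp [Matrix.IsHermitian, Matrix.conjTranspose_eq_transpose_of_trivial]
  obtain ⟨U, d, hU, hd⟩ : ∃ (U : Matrix n n ℝ) (d : n → ℝ), Uᵀ * U = 1 ∧
      Bᵀ * B = U * diagonal d * Uᵀ := by
    refine ⟨hH.eigenvectorUnitary, hH.eigenvalues, ?_, ?_⟩
    · exact Unitary.coe_star_mul_self hH.eigenvectorUnitary
    · conv_lhs => rw [hH.spectral_theorem]
      rfl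
  obtain ⟨G, hGt, hHGH, hGHG, hc⟩ : ∃ G : Matrix n n ℝ, Gᵀ = G ∧
      (Bᵀ * B) * (G * (Bᵀ * B)) = Bᵀ * B ∧ G * ((Bᵀ * B) * G) = G ∧
      (Bᵀ * B) * G = G * (Bᵀ * B) := by
    have key : ∀ a b : n → ℝ, (U * diagonal a * Uᵀ) * (U * diagonal b * Uᵀ) =
        U * diagonal (fun i => a i * b i) * Uᵀ := by
      intro a b
      calc _ = U * diagonal a * (Uᵀ * U) * diagonal b * Uᵀ := by simp only [Matrix.mul_assoc]
        _ = _ := by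
          rw [hU, Matrix.mul_one, Matrix.mul_assoc U, diagonal_mul_diagonal]
    refine ⟨U * diagonal (fun i => (d i)⁻¹) * Uᵀ, ?_, ?_, ?_, ?_⟩
    · simp [Matrix.transpose_mul, Matrix.mul_assoc]
    · rw [hd, key, key]
      congr 3
      funext i
      by_cases h : d i = 0 <;> simp [h]
    · rw [hd, key, key]
      congr 3
      funext i
      by_cases h : d i = 0 <;> simp [h]
    · rw [hd, key, key]
      simp only [mul_comm]
  have hB : B * (G * (Bᵀ * B)) = B := by
    have h0 : Bᵀ * (B - B * (G * (Bᵀ * B))) = 0 := by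
      rw [Matrix.mul_sub, ← Matrix.mul_assoc Bᵀ B, hHGH, sub_self]
    have h1 : (B - B * (G * (Bᵀ * B)))ᵀ * (B - B * (G * (Bᵀ * B))) = 0 := by
      have : (B - B * (G * (Bᵀ * B)))ᵀ = (1 - (G * (Bᵀ * B)))ᵀ * Bᵀ := by
        rw [← Matrix.transpose_mul, Matrix.mul_sub, Matrix.mul_one]
      rw [this, Matrix.mul_assoc, h0, Matrix.mul_zero]
    have h2 := Matrix.conjTranspose_mul_self_eq_zero.mp
      (by rwa [Matrix.conjTranspose_eq_transpose_of_trivial] :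
        (B - B * (G * (Bᵀ * B)))ᴴ * (B - B * (G * (Bᵀ * B))) = 0)
    exact (sub_eq_zero.mp h2).symm
  refine ⟨G * Bᵀ, ?_, ?_, ?_, ?_⟩
  · simpa only [Matrix.mul_assoc] using hB
  · have := congrArg (· * Bᵀ) hGHG
    simpa only [Matrix.mul_assoc] using this
  · simp [Matrix.transpose_mul, hGt, Matrix.mul_assoc]
  · rw [Matrix.mul_assoc, Matrix.transpose_mul, hGt, ← hc, Matrix.transpose_mul,
      Matrix.transpose_transpose]

/-- The Moore-Penrose pseudo-inverse `B†`. -/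
noncomputable def pinv {m n : Type*} [Fintype m] [Fintype n] (B : Matrix m n ℝ) :
    Matrix n m ℝ := (exists_isMoorePenrose B).choose

theorem pinv_isMoorePenrose {m n : Type*} [Fintype m] [Fintype n]
    (B : Matrix m n ℝ) : IsMoorePenrose B (pinv B) := (exists_isMoorePenrose B).choose_spec

/-- The vector `b` with `b_S = A_S† y` and `b_{Sᶜ} = 0`. -/
noncomputable def lsOn {M N : ℕ} (A : Matrix (Fin M) (Fin N) ℝ) (S : Finset (Fin N))
    (y : Fin M → ℝ) : Fin N → ℝ :=
  fun i => if h : i ∈ S then (pinv (colSub A S) *ᵥ y) ⟨i, h⟩ else 0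

/-- `x 0, x 1, x 2, …` are the successive solutions of CoSaMP with sparsity level `K` run on the
measurement vector `y`: `x 0 = 0`, and in each iteration, with `u = Aᵀ (y - A x)`, the set
`supp u_{2K}` is merged with `supp x`, the least squares solution `b` on the merged set is formed,
and the new solution is `b_K`. -/
structure IsCoSaMP {M N : ℕ} (A : Matrix (Fin M) (Fin N) ℝ) (y : Fin M → ℝ) (K : ℕ)
    (x : ℕ → Fin N → ℝ) : Prop where
  init : x 0 = 0
  step : ∀ l, ∃ v : Fin N → ℝ, IsBestApprox (2 * K) (Aᵀ *ᵥ (y - A *ᵥ x l)) v ∧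
    IsBestApprox K (lsOn A (supp v ∪ supp (x l)) y) (x (l + 1))

/-- `T l` and `x l` are the support estimates and the solutions of SP with sparsity level `K` run
on the measurement vector `y`: initially `T 0 = supp (Aᵀ y)_K`; in each iteration, with
`u = Aᵀ (y - A x)`, the set `supp u_K` is merged with `T`, the least squares solution `p` on the
merged set is formed, and the new support estimate is `supp p_K`; the solution is always the least
squares solution on the current support estimate. -/
structure IsSP {M N : ℕ} (A : Matrix (Fin M) (Fin N) ℝ) (y : Fin M → ℝ) (K : ℕ)
    (T : ℕ → Finset (Fin N)) (x : ℕ → Fin N → ℝ) : Prop where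
  init : ∃ v : Fin N → ℝ, IsBestApprox K (Aᵀ *ᵥ y) v ∧ T 0 = supp v
  step : ∀ l, ∃ v p : Fin N → ℝ, IsBestApprox K (Aᵀ *ᵥ (y - A *ᵥ x l)) v ∧
    IsBestApprox K (lsOn A (supp v ∪ T l) y) p ∧ T (l + 1) = supp p
  sol : ∀ l, x l = lsOn A (T l) y

/-- `x 0, x 1, x 2, …` are the successive solutions of IHT with sparsity level `K` run on the
measurement vector `y`: `x 0 = 0`, and each iteration replaces `x` by `(x + Aᵀ (y - A x))_K`. -/
structure IsIHT {M N : ℕ} (A : Matrix (Fin M) (Fin N) ℝ) (y : Fin M → ℝ) (K : ℕ)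
    (x : ℕ → Fin N → ℝ) : Prop where
  init : x 0 = 0
  step : ∀ l, IsBestApprox K (x l + Aᵀ *ᵥ (y - A *ᵥ x l)) (x (l + 1))

namespace CoSaMP

/-- The contraction factor of CoSaMP, with `δ = δ_{4K}`. -/
noncomputable def C (δ : ℝ) : ℝ := 4 * δ / (1 - δ) ^ 2

/-- The noise factor of one iteration of CoSaMP. -/
noncomputable def C₁ (δ : ℝ) : ℝ := (6 + 2 * δ) / (1 - δ) ^ 2

/-- The total noise factor of CoSaMP. -/
noncomputable def D (δ : ℝ) : ℝ := (6 + 2 * δ) / (1 - 6 * δ + δ ^ 2)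

end CoSaMP

namespace SP

/-- The contraction factor of SP, with `δ = δ_{3K}`. -/
noncomputable def C (δ : ℝ) : ℝ := (2 * δ + 2 * δ ^ 2) / (1 - δ) ^ 3

/-- The noise factor of one iteration of SP. -/
noncomputable def C₁ (δ : ℝ) : ℝ := 4 * (1 + δ) / (1 - δ) ^ 2

/-- The total noise factor of SP. -/
noncomputable def D (δ : ℝ) : ℝ :=
  (5 - 4 * δ - 8 * δ ^ 2 - δ ^ 4) / (1 - 6 * δ + 6 * δ ^ 2 - 2 * δ ^ 3 + δ ^ 4)

end SP

namespace IHT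

/-- The contraction factor of IHT, with `δ = δ_{3K}`. -/
noncomputable def C (δ : ℝ) : ℝ := Real.sqrt 8 * δ

/-- The noise factor of one iteration of IHT. -/
noncomputable def C₁ (δ : ℝ) : ℝ := 2 * Real.sqrt (1 + δ)

/-- The total noise factor of IHT. -/
noncomputable def D (δ : ℝ) : ℝ := 2 * Real.sqrt (1 + δ) / (1 - Real.sqrt 8 * δ)

end IHT

end GreedyPursuit

/-! The restricted isometry property says that `Aᵀ A` is nearly the identity on sparse vectors.
Polarization gives ⟨Ax, Ay⟩ − ⟨x, y⟩ ≤ δ‖x‖‖y‖ for `x`, `y` supported in one small set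
(`mulVec_dotProduct_mulVec_sub_le`), and everything else rests on two consequences.

Gradient: with r the current error, u = Aᵀ(Ar + e) is within δ‖r‖ + √(1+δ)‖e‖ of r on small sets
(`l2norm_restr_gradient_sub_le`). A set chosen because u is large there can therefore miss only a
small part of r (`l2norm_restr_le_of_gradient_le`).

Least squares: the fit on T makes the residual orthogonal to the columns in T, so its error on T is
controlled by δ times the part of s outside T, plus noise (`mul_l2norm_restr_sub_lsOn_le`).

IHT needs only the gradient estimate. CoSaMP and SP use it to identify indices, then the least
squares estimate, then a comparison of best approximations for the pruning. Each yields an affine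
recursion with factor C, which is iterated; for SP the recursion concerns the missed part of the
support, and one more least squares bound passes to the iterate. -/

namespace GreedyPursuit

/-! ### Euclidean norm -/

section Norm

variable {ι : Type*} [Fintype ι]

theorem l2norm_nonneg (x : ι → ℝ) : 0 ≤ l2norm x := norm_nonneg _

theorem l2norm_sq (x : ι → ℝ) : l2norm x ^ 2 = ∑ i, x i ^ 2 := by
  simp [l2norm, EuclideanSpace.real_norm_sq_eq]

theorem l2norm_sq_eq_dotProduct (x : ι → ℝ) : l2norm x ^ 2 = x ⬝ᵥ x := by
  rw [l2norm_sq]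
  simp only [dotProduct, sq]

theorem l2norm_add_le (x y : ι → ℝ) : l2norm (x + y) ≤ l2norm x + l2norm y :=
  norm_add_le (WithLp.toLp 2 x) (WithLp.toLp 2 y)

theorem l2norm_sub_le (x y : ι → ℝ) : l2norm (x - y) ≤ l2norm x + l2norm y :=
  norm_sub_le (WithLp.toLp 2 x) (WithLp.toLp 2 y)

theorem l2norm_sub_comm (x y : ι → ℝ) : l2norm (x - y) = l2norm (y - x) :=
  norm_sub_rev (WithLp.toLp 2 x) (WithLp.toLp 2 y)

theorem l2norm_smul (c : ℝ) (x : ι → ℝ) : l2norm (c • x) = |c| * l2norm x :=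
  norm_smul c (WithLp.toLp 2 x)

theorem dotProduct_le_l2norm_mul (x y : ι → ℝ) : x ⬝ᵥ y ≤ l2norm x * l2norm y := by
  have h : (x ⬝ᵥ y) ^ 2 ≤ (l2norm x * l2norm y) ^ 2 := by
    rw [mul_pow, l2norm_sq, l2norm_sq]
    exact Finset.sum_mul_sq_le_sq_mul_sq _ _ _
  exact le_of_sq_le_sq h (mul_nonneg (l2norm_nonneg x) (l2norm_nonneg y))

theorem l2norm_le_l2norm_of_abs_le {x y : ι → ℝ} (h : ∀ i, |x i| ≤ |y i|) :
    l2norm x ≤ l2norm y := by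
  refine le_of_sq_le_sq ?_ (l2norm_nonneg y)
  rw [l2norm_sq, l2norm_sq]
  exact Finset.sum_le_sum fun i _ => sq_le_sq.mpr (h i)

/-- A vector `w` with `⟨w, w⟩ ≤ c ‖w‖` has norm at most `c`. -/
theorem l2norm_le_of_sq_le {w : ι → ℝ} {c : ℝ} (hc : 0 ≤ c)
    (h : l2norm w ^ 2 ≤ c * l2norm w) : l2norm w ≤ c := by
  rcases (l2norm_nonneg w).eq_or_lt with h0 | h0
  · rwa [← h0]
  · exact le_of_mul_le_mul_right (by rwa [← sq]) h0

end Norm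

/-! ### Restriction to index sets and best k-term approximation -/

section Restriction

variable {N : ℕ}

/-- The vector that agrees with `x` on `S` and vanishes off `S`. -/
noncomputable def restr (S : Finset (Fin N)) (x : Fin N → ℝ) : Fin N → ℝ :=
  fun i => if i ∈ S then x i else 0

theorem restr_of_mem {S : Finset (Fin N)} {i : Fin N} (h : i ∈ S) (x : Fin N → ℝ) :
    restr S x i = x i := if_pos h

theorem restr_of_notMem {S : Finset (Fin N)} {i : Fin N} (h : i ∉ S) (x : Fin N → ℝ) :
    restr S x i = 0 := if_neg h

theorem l2norm_restr_sq (S : Finset (Fin N)) (x : Fin N → ℝ) :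
    l2norm (restr S x) ^ 2 = ∑ i ∈ S, x i ^ 2 := by
  simp [l2norm_sq, restr, ite_pow]

theorem l2norm_restr_le (S : Finset (Fin N)) (x : Fin N → ℝ) : l2norm (restr S x) ≤ l2norm x := by
  refine l2norm_le_l2norm_of_abs_le fun i => ?_
  by_cases h : i ∈ S <;> simp [restr, h]

theorem l2norm_restr_mono {S T : Finset (Fin N)} (h : S ⊆ T) (x : Fin N → ℝ) :
    l2norm (restr S x) ≤ l2norm (restr T x) := by
  refine l2norm_le_l2norm_of_abs_le fun i => ?_
  by_cases hS : i ∈ S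
  · simp [restr, hS, h hS]
  · simp [restr, hS]

theorem l2norm_subvec (S : Finset (Fin N)) (x : Fin N → ℝ) :
    l2norm (subvec S x) = l2norm (restr S x) := by
  refine (sq_eq_sq₀ (l2norm_nonneg _) (l2norm_nonneg _)).mp ?_
  rw [l2norm_restr_sq, l2norm_sq, ← Finset.sum_coe_sort S]
  rfl

theorem restr_dotProduct_restr (S : Finset (Fin N)) (x : Fin N → ℝ) :
    restr S x ⬝ᵥ restr S x = restr S x ⬝ᵥ x := by
  refine Finset.sum_congr rfl fun i _ => ?_
  by_cases h : i ∈ S <;> simp [restr, h]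

theorem apply_eq_zero_of_notMem_supp {x : Fin N → ℝ} {i : Fin N} (h : i ∉ supp x) : x i = 0 := by
  simpa [supp] using h

theorem isSparse_of_eq_zero {K : ℕ} {x : Fin N → ℝ} {B : Finset (Fin N)} (hB : B.card ≤ K)
    (h : ∀ i ∉ B, x i = 0) : IsSparse K x := by
  refine (Finset.card_le_card fun i hi => ?_).trans hB
  by_contra hiB
  simp [supp, h i hiB] at hi

/-- Comparison of `v` with the competitor `restr S u`: on `supp v` the error of `v` is at least 0,
off it the error is the entry of `u` itself. Indices in both sets or in neither can only help. -/
theorem IsBestApprox.l2norm_restr_sdiff_le {K : ℕ} {u v : Fin N → ℝ} (h : IsBestApprox K u v)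
    {S : Finset (Fin N)} (hS : S.card ≤ K) :
    l2norm (restr (S \ supp v) u) ≤ l2norm (restr (supp v \ S) u) := by
  refine le_of_sq_le_sq ?_ (l2norm_nonneg _)
  have h1 : l2norm (u - v) ^ 2 ≤ l2norm (u - restr S u) ^ 2 :=
    pow_le_pow_left₀ (l2norm_nonneg _)
      (h.2 _ (isSparse_of_eq_zero hS fun i hi => restr_of_notMem hi u)) 2
  rw [l2norm_sq, l2norm_sq] at h1
  have key : ∀ i, (restr (S \ supp v) u i) ^ 2 - (restr (supp v \ S) u i) ^ 2 ≤
      ((u - v) i) ^ 2 - ((u - restr S u) i) ^ 2 := by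
    intro i
    by_cases hv : i ∈ supp v
    · by_cases hi : i ∈ S <;> simp [restr, hv, hi] <;> nlinarith [sq_nonneg (u i - v i)]
    · have := apply_eq_zero_of_notMem_supp hv
      by_cases hi : i ∈ S <;> simp [restr, hv, hi, this]
  have h2 := Finset.sum_le_sum fun i (_ : i ∈ Finset.univ) => key i
  rw [Finset.sum_sub_distrib, Finset.sum_sub_distrib, ← l2norm_sq, ← l2norm_sq] at h2
  linarith

end Restriction

/-! ### Consequences of the restricted isometry property -/

section RestrictedIsometry

variable {M N k : ℕ} {A : Matrix (Fin M) (Fin N) ℝ} {δ : ℝ}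

/-- Polarization: the upper bound at x + y and the lower bound at x − y give the estimate with the
arithmetic mean of ‖x‖² and ‖y‖²; rescaling replaces it by ‖x‖‖y‖. -/
theorem mulVec_dotProduct_mulVec_sub_le (hδ : δ ∈ ripSet A k) {B : Finset (Fin N)}
    (hB : B.card ≤ k) {x y : Fin N → ℝ} (hx : ∀ i ∉ B, x i = 0) (hy : ∀ i ∉ B, y i = 0) :
    (A *ᵥ x) ⬝ᵥ (A *ᵥ y) - x ⬝ᵥ y ≤ δ * (l2norm x * l2norm y) := by
  have half : ∀ x y : Fin N → ℝ, (∀ i ∉ B, x i = 0) → (∀ i ∉ B, y i = 0) →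
      (A *ᵥ x) ⬝ᵥ (A *ᵥ y) - x ⬝ᵥ y ≤ δ * (l2norm x ^ 2 + l2norm y ^ 2) / 2 := by
    intro x y hx hy
    have hp := (hδ.2 (x + y) (isSparse_of_eq_zero hB fun i hi => by simp [hx i hi, hy i hi])).2
    have hm := (hδ.2 (x - y) (isSparse_of_eq_zero hB fun i hi => by simp [hx i hi, hy i hi])).1
    simp only [l2norm_sq_eq_dotProduct, mulVec_add, mulVec_sub, add_dotProduct, dotProduct_add,
      sub_dotProduct, dotProduct_sub] at hp hm ⊢
    rw [dotProduct_comm (A *ᵥ y) (A *ᵥ x), dotProduct_comm y x] at hp hm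
    linarith
  rcases (l2norm_nonneg x).eq_or_lt with hx0 | hx0
  · have h0 : x = 0 := by
      have : WithLp.toLp 2 x = 0 := norm_eq_zero.mp hx0.symm
      simpa using this
    simp [h0, l2norm]
  rcases (l2norm_nonneg y).eq_or_lt with hy0 | hy0
  · have h0 : y = 0 := by
      have : WithLp.toLp 2 y = 0 := norm_eq_zero.mp hy0.symm
      simpa using this
    simp [h0, l2norm]
  -- The rescaled vectors have equal norms, which makes the arithmetic-geometric mean inequality an
  -- equality.
  have h := half (l2norm y • x) (l2norm x • y) (fun i hi => by simp [hx i hi])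
    (fun i hi => by simp [hy i hi])
  simp only [mulVec_smul, smul_dotProduct, dotProduct_smul, l2norm_smul, smul_eq_mul,
    abs_of_pos hx0, abs_of_pos hy0] at h
  refine le_of_mul_le_mul_left ?_ (mul_pos hx0 hy0)
  linarith

theorem l2norm_mulVec_le (hδ : δ ∈ ripSet A k) {x : Fin N → ℝ} (hx : IsSparse k x) :
    l2norm (A *ᵥ x) ≤ √(1 + δ) * l2norm x := by
  refine le_of_sq_le_sq ?_ (mul_nonneg (Real.sqrt_nonneg _) (l2norm_nonneg _))
  rw [mul_pow, Real.sq_sqrt (by linarith [hδ.1])]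
  exact (hδ.2 x hx).2

/-- The gradient `Aᵀ (A r + e)` is close to `r` on every small set. -/
theorem l2norm_restr_gradient_sub_le (hδ : δ ∈ ripSet A k) {B P : Finset (Fin N)}
    (hB : B.card ≤ k) (hPB : P ⊆ B) {r : Fin N → ℝ} (hr : ∀ i ∉ B, r i = 0) (e : Fin M → ℝ) :
    l2norm (restr P (Aᵀ *ᵥ (A *ᵥ r + e) - r)) ≤ δ * l2norm r + √(1 + δ) * l2norm e := by
  have h0 : 0 ≤ δ * l2norm r + √(1 + δ) * l2norm e :=
    add_nonneg (mul_nonneg hδ.1 (l2norm_nonneg _))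
      (mul_nonneg (Real.sqrt_nonneg _) (l2norm_nonneg _))
  refine l2norm_le_of_sq_le h0 ?_
  rw [l2norm_sq_eq_dotProduct, restr_dotProduct_restr]
  -- `w` is its own test vector: ‖w‖² = (⟨Aw, Ar⟩ − ⟨w, r⟩) + ⟨Aw, e⟩. The bilinear bound handles
  -- the bracket, Cauchy–Schwarz the noise.
  set w := restr P (Aᵀ *ᵥ (A *ᵥ r + e) - r)
  have hw : ∀ i ∉ B, w i = 0 := fun i hi => restr_of_notMem (fun h => hi (hPB h)) _
  have h1 := mulVec_dotProduct_mulVec_sub_le hδ hB hw hr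
  have h2 := dotProduct_le_l2norm_mul (A *ᵥ w) e
  have h3 := mul_le_mul_of_nonneg_right (l2norm_mulVec_le hδ (isSparse_of_eq_zero hB hw))
    (l2norm_nonneg e)
  have h4 : w ⬝ᵥ (Aᵀ *ᵥ (A *ᵥ r + e) - r) =
      ((A *ᵥ w) ⬝ᵥ (A *ᵥ r) - w ⬝ᵥ r) + (A *ᵥ w) ⬝ᵥ e := by
    rw [dotProduct_sub, dotProduct_mulVec, vecMul_transpose, dotProduct_add]
    ring
  rw [h4]
  linarith

/-- If the gradient is at most as large on `P` as on a set `Q` where `r` vanishes, then `r` is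
small on `P`. -/
theorem l2norm_restr_le_of_gradient_le (hδ : δ ∈ ripSet A k) {B P Q : Finset (Fin N)}
    (hB : B.card ≤ k) (hPB : P ⊆ B) (hQB : Q ⊆ B) {r : Fin N → ℝ} (hr : ∀ i ∉ B, r i = 0)
    (hrQ : ∀ i ∈ Q, r i = 0) (e : Fin M → ℝ)
    (hle : l2norm (restr P (Aᵀ *ᵥ (A *ᵥ r + e))) ≤ l2norm (restr Q (Aᵀ *ᵥ (A *ᵥ r + e)))) :
    l2norm (restr P r) ≤ 2 * (δ * l2norm r + √(1 + δ) * l2norm e) := by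
  -- The same error bound is paid twice: for u − r on `P`, and for u on `Q`, where r = 0.
  have hP := l2norm_restr_gradient_sub_le hδ hB hPB hr e
  have hQ := l2norm_restr_gradient_sub_le hδ hB hQB hr e
  set u := Aᵀ *ᵥ (A *ᵥ r + e)
  have h1 : restr P r = restr P u - restr P (u - r) := by
    funext i
    by_cases h : i ∈ P <;> simp [restr, h]
  have h2 : restr Q (u - r) = restr Q u := by
    funext i
    by_cases h : i ∈ Q
    · simp [restr, h, hrQ i h]
    · simp [restr, h]
  rw [h2] at hQ
  have h3 := l2norm_sub_le (restr P u) (restr P (u - r))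
  rw [h1]
  linarith

end RestrictedIsometry

/-! ### Least squares on a given support -/

section LeastSquares

variable {M N k : ℕ} {A : Matrix (Fin M) (Fin N) ℝ} {δ : ℝ}

theorem lsOn_of_notMem {T : Finset (Fin N)} {i : Fin N} (h : i ∉ T) (y : Fin M → ℝ) :
    lsOn A T y i = 0 := dif_neg h

theorem mulVec_lsOn (T : Finset (Fin N)) (y : Fin M → ℝ) :
    A *ᵥ lsOn A T y = colSub A T *ᵥ (pinv (colSub A T) *ᵥ y) := by
  funext j
  simp only [mulVec, dotProduct]
  rw [← Finset.sum_subset (Finset.subset_univ T) fun i _ hi => by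
    rw [lsOn_of_notMem hi, mul_zero], ← Finset.sum_coe_sort T]
  refine Finset.sum_congr rfl fun i _ => ?_
  simp [lsOn, colSub, mulVec, dotProduct]

/-- The normal equations of the least squares solution. -/
theorem gradient_lsOn_eq_zero {T : Finset (Fin N)} {i : Fin N} (hi : i ∈ T) (y : Fin M → ℝ) :
    (Aᵀ *ᵥ (y - A *ᵥ lsOn A T y)) i = 0 := by
  have hP := pinv_isMoorePenrose (colSub A T)
  -- Bᵀ B B† = Bᵀ, by transposing B B† B = B and using the symmetry of B B†; full column rank is not
  -- needed.
  have h1 : (colSub A T)ᵀ * (colSub A T * pinv (colSub A T)) = (colSub A T)ᵀ := by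
    rw [← hP.symm_left, ← transpose_mul, hP.mul_mul_left]
  have h2 : (colSub A T)ᵀ *ᵥ (y - A *ᵥ lsOn A T y) = 0 := by
    rw [mulVec_lsOn, mulVec_sub, mulVec_mulVec, mulVec_mulVec, Matrix.mul_assoc, h1,
      sub_self]
  exact congrFun h2 ⟨i, hi⟩

/-- Split s − b = d + g into its parts on and off `T`. Testing the normal equations with d gives
‖Ad‖² = −⟨Ad, Ag⟩ − ⟨Ad, e⟩. Since d ⊥ g, the cross term is at most δ‖d‖‖g‖, while ‖Ad‖² ≥ (1 −
δ)‖d‖²; then divide by ‖d‖. -/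
theorem mul_l2norm_restr_sub_lsOn_le (hδ : δ ∈ ripSet A k) {s : Fin N → ℝ} {e : Fin M → ℝ}
    {T : Finset (Fin N)} (hT : (supp s ∪ T).card ≤ k) :
    (1 - δ) * l2norm (restr T (s - lsOn A T (A *ᵥ s + e))) ≤
      δ * l2norm (restr (supp s \ T) s) + √(1 + δ) * l2norm e := by
  set b := lsOn A T (A *ᵥ s + e) with hb
  set d := restr T (s - b) with hd
  set g := restr (supp s \ T) s with hg
  have hsub : s - b = d + g := by
    funext i
    by_cases hi : i ∈ T
    · simp [hd, hg, restr, hi]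
    · by_cases his : i ∈ supp s
      · simp [hd, hg, restr, hi, his, hb, lsOn_of_notMem hi]
      · simp [hd, hg, restr, hi, his, hb, lsOn_of_notMem hi, apply_eq_zero_of_notMem_supp his]
  have hdB : ∀ i ∉ supp s ∪ T, d i = 0 := fun i hi =>
    restr_of_notMem (fun h => hi (Finset.mem_union_right _ h)) _
  have hgB : ∀ i ∉ supp s ∪ T, (-g) i = 0 := fun i hi => by
    rw [Pi.neg_apply, neg_eq_zero]
    exact restr_of_notMem
      (fun h => hi (Finset.mem_union_left _ (Finset.mem_sdiff.mp h).1)) _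
  have hnormal : d ⬝ᵥ (Aᵀ *ᵥ (A *ᵥ s + e - A *ᵥ b)) = 0 := by
    refine Finset.sum_eq_zero fun i _ => ?_
    by_cases hi : i ∈ T
    · rw [gradient_lsOn_eq_zero hi, mul_zero]
    · rw [hd, restr_of_notMem hi, zero_mul]
  have hres : A *ᵥ s + e - A *ᵥ b = A *ᵥ d + A *ᵥ g + e := by
    rw [← mulVec_add, ← hsub, mulVec_sub]
    abel
  rw [hres, dotProduct_mulVec, vecMul_transpose, dotProduct_add, dotProduct_add,
    ← l2norm_sq_eq_dotProduct] at hnormal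
  have hdg : d ⬝ᵥ g = 0 := by
    refine Finset.sum_eq_zero fun i _ => ?_
    by_cases hi : i ∈ T <;> simp [hd, hg, restr, hi]
  -- The bilinear bound is one-sided, so it is applied to −g; likewise −e below.
  have h1 := mulVec_dotProduct_mulVec_sub_le hδ hT hdB hgB
  rw [mulVec_neg, dotProduct_neg, dotProduct_neg, hdg,
    show l2norm (-g) = l2norm g from norm_neg (WithLp.toLp 2 g)] at h1
  have h2 := dotProduct_le_l2norm_mul (A *ᵥ d) (-e)
  rw [dotProduct_neg, show l2norm (-e) = l2norm e from norm_neg (WithLp.toLp 2 e)] at h2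
  have hdS : IsSparse k d := isSparse_of_eq_zero hT hdB
  have h3 := mul_le_mul_of_nonneg_right (l2norm_mulVec_le hδ hdS) (l2norm_nonneg e)
  have h4 := (hδ.2 d hdS).1
  rcases (l2norm_nonneg d).eq_or_lt with h0 | h0
  · rw [← h0, mul_zero]
    exact add_nonneg (mul_nonneg hδ.1 (l2norm_nonneg _))
      (mul_nonneg (Real.sqrt_nonneg _) (l2norm_nonneg _))
  · refine le_of_mul_le_mul_right ?_ h0
    linarith

theorem l2norm_sub_lsOn_le_add (s : Fin N → ℝ) (T : Finset (Fin N)) (y : Fin M → ℝ) :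
    l2norm (s - lsOn A T y) ≤
      l2norm (restr T (s - lsOn A T y)) + l2norm (restr (supp s \ T) s) := by
  have hsub : s - lsOn A T y = restr T (s - lsOn A T y) + restr (supp s \ T) s := by
    funext i
    by_cases hi : i ∈ T
    · simp [restr, hi]
    · by_cases his : i ∈ supp s
      · simp [restr, hi, his, lsOn_of_notMem hi]
      · simp [restr, hi, his, lsOn_of_notMem hi, apply_eq_zero_of_notMem_supp his]
  conv_lhs => rw [hsub]
  exact l2norm_add_le _ _

/-- The part off `T` enters with weight 1 − δ directly and δ through the error on `T`, in total 1.
-/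
theorem mul_l2norm_sub_lsOn_le (hδ : δ ∈ ripSet A k) (hδ1 : δ < 1) {s : Fin N → ℝ}
    {e : Fin M → ℝ} {T : Finset (Fin N)} (hT : (supp s ∪ T).card ≤ k) :
    (1 - δ) * l2norm (s - lsOn A T (A *ᵥ s + e)) ≤
      l2norm (restr (supp s \ T) s) + √(1 + δ) * l2norm e := by
  have h1 := mul_l2norm_restr_sub_lsOn_le (e := e) hδ hT
  have h2 := mul_le_mul_of_nonneg_left (l2norm_sub_lsOn_le_add (A := A) s T (A *ᵥ s + e))
    (sub_nonneg.mpr hδ1.le)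
  linarith

end LeastSquares

/-! ### Scalar inequalities -/

section Real

theorem sqrt_one_add_le {δ : ℝ} (hδ : 0 ≤ δ) : √(1 + δ) ≤ 1 + δ / 2 := by
  rw [Real.sqrt_le_left (by linarith)]
  nlinarith [sq_nonneg δ]

/-- Iterating an affine contraction. -/
theorem le_pow_mul_add_of_le_mul_add {f : ℕ → ℝ} {c d : ℝ} (hc0 : 0 ≤ c) (hc1 : c < 1)
    (hd : 0 ≤ d) (h : ∀ l, f (l + 1) ≤ c * f l + d) (l : ℕ) :
    f l ≤ c ^ l * f 0 + d / (1 - c) := by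
  have h1 : 0 < 1 - c := sub_pos.mpr hc1
  induction l with
  | zero => simpa using div_nonneg hd h1.le
  | succ l ih =>
    -- d / (1 − c) is the fixed point of t ↦ c t + d.
    have h2 : c * (d / (1 - c)) + d = d / (1 - c) := by
      field_simp
      ring
    have h3 := mul_le_mul_of_nonneg_left ih hc0
    rw [pow_succ]
    linarith [h l]

end Real

/-! ### One-step estimates for the three algorithms -/

section Algorithms

variable {M N K : ℕ} {A : Matrix (Fin M) (Fin N) ℝ} {s : Fin N → ℝ} {e : Fin M → ℝ} {δ : ℝ}

theorem residual_eq (x : Fin N → ℝ) : A *ᵥ s + e - A *ᵥ x = A *ᵥ (s - x) + e := by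
  rw [mulVec_sub]
  abel

theorem sub_eq_zero_of_notMem_union {x : Fin N → ℝ} {B : Finset (Fin N)}
    (hB : supp s ∪ supp x ⊆ B) : ∀ i ∉ B, (s - x) i = 0 := by
  intro i hi
  have hsi : i ∉ supp s := fun h => hi (hB (Finset.mem_union_left _ h))
  have hxi : i ∉ supp x := fun h => hi (hB (Finset.mem_union_right _ h))
  simp [apply_eq_zero_of_notMem_supp hsi, apply_eq_zero_of_notMem_supp hxi]

theorem card_union_le_add {α : Type*} [DecidableEq α] {S T : Finset α} {m n : ℕ}
    (hS : S.card ≤ m) (hT : T.card ≤ n) : (S ∪ T).card ≤ m + n :=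
  (Finset.card_union_le S T).trans (add_le_add hS hT)

theorem supp_zero : supp (0 : Fin N → ℝ) = ∅ := by simp [supp]

theorem IsCoSaMP.isSparse {y : Fin M → ℝ} {x : ℕ → Fin N → ℝ} (h : IsCoSaMP A y K x) :
    ∀ l, IsSparse K (x l)
  | 0 => by simp [h.init, IsSparse, supp_zero]
  | l + 1 => (h.step l).choose_spec.2.1

theorem IsIHT.isSparse {y : Fin M → ℝ} {x : ℕ → Fin N → ℝ} (h : IsIHT A y K x) :
    ∀ l, IsSparse K (x l)
  | 0 => by simp [h.init, IsSparse, supp_zero]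
  | l + 1 => (h.step l).1

theorem IsSP.card_le {y : Fin M → ℝ} {T : ℕ → Finset (Fin N)} {x : ℕ → Fin N → ℝ}
    (h : IsSP A y K T x) : ∀ l, (T l).card ≤ K
  | 0 => by
    obtain ⟨v, hv, hT⟩ := h.init
    exact hT ▸ hv.1
  | l + 1 => by
    obtain ⟨v, p, -, hp, hT⟩ := h.step l
    exact hT ▸ hp.1

/-- With z = `x l + u`, both z − `x (l + 1)` and z − s restrict to P, the first no larger than the
second. The second is u − r on P, so twice the gradient estimate bounds the new error. No lower
isometry bound is divided by, hence no condition on δ. -/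
theorem IsIHT.step_le (hδ : δ ∈ ripSet A (3 * K)) (hs : IsSparse K s) {x : ℕ → Fin N → ℝ}
    (h : IsIHT A (A *ᵥ s + e) K x) (l : ℕ) :
    l2norm (s - x (l + 1)) ≤ IHT.C δ * l2norm (s - x l) + IHT.C₁ δ * l2norm e := by
  have hbest := (h.step l).2 s hs
  rw [residual_eq] at hbest
  set u := Aᵀ *ᵥ (A *ᵥ (s - x l) + e) with hu
  set P := supp s ∪ supp (x (l + 1)) with hP
  -- The supports of s and of two consecutive iterates: this is the source of the order 3K.
  have hcard : (P ∪ supp (x l)).card ≤ 3 * K :=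
    (card_union_le_add (card_union_le_add hs (h.isSparse (l + 1))) (h.isSparse l)).trans
      (by omega)
  have hgrad : l2norm (restr P (u - (s - x l))) ≤ δ * l2norm (s - x l) + √(1 + δ) * l2norm e :=
    l2norm_restr_gradient_sub_le hδ hcard Finset.subset_union_left
      (sub_eq_zero_of_notMem_union (Finset.union_subset_union_left Finset.subset_union_left)) e
  have hsP : ∀ i ∉ P, s i = 0 := fun i hi =>
    apply_eq_zero_of_notMem_supp fun h => hi (Finset.mem_union_left _ h)
  have hxP : ∀ i ∉ P, x (l + 1) i = 0 := fun i hi =>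
    apply_eq_zero_of_notMem_supp fun h => hi (Finset.mem_union_right _ h)
  -- both `s` and `x (l + 1)` vanish off `P`, so optimality persists after restriction to `P`
  have hsplit : ∀ w : Fin N → ℝ, (∀ i ∉ P, w i = 0) →
      l2norm (x l + u - w) ^ 2 =
        l2norm (restr P (x l + u - w)) ^ 2 + l2norm (restr Pᶜ (x l + u)) ^ 2 := by
    intro w hw
    rw [l2norm_restr_sq, l2norm_restr_sq, l2norm_sq, ← Finset.sum_add_sum_compl P]
    congr 1
    refine Finset.sum_congr rfl fun i hi => ?_
    simp [hw i (Finset.mem_compl.mp hi)]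
  have hrestr : l2norm (restr P (x l + u - x (l + 1))) ≤ l2norm (restr P (x l + u - s)) := by
    refine le_of_sq_le_sq ?_ (l2norm_nonneg _)
    have := pow_le_pow_left₀ (l2norm_nonneg _) hbest 2
    rw [hsplit _ hsP, hsplit _ hxP] at this
    linarith
  have hdecomp : s - x (l + 1) = restr P (x l + u - x (l + 1)) - restr P (x l + u - s) := by
    funext i
    by_cases hi : i ∈ P
    · simp [restr, hi]
    · simp [restr, hi, hsP i hi, hxP i hi]
  have htri := l2norm_sub_le (restr P (x l + u - x (l + 1))) (restr P (x l + u - s))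
  rw [← hdecomp] at htri
  rw [show u - (s - x l) = x l + u - s by abel] at hgrad
  -- The argument yields the factor 2δ, which is relaxed to √8 δ.
  have h2 : (2 : ℝ) ≤ √8 := Real.le_sqrt_of_sq_le (by norm_num)
  have h3 := mul_le_mul_of_nonneg_right h2 (mul_nonneg hδ.1 (l2norm_nonneg (s - x l)))
  simp only [IHT.C, IHT.C₁]
  linarith

/-- The error r lives on R = supp s ∪ supp (x l), of size at most 2K, which is why 2K indices are
selected: the selection competes with all of R. What is missed is small, least squares keeps the
error comparable to it, and pruning at most doubles it. -/
theorem IsCoSaMP.step_le (hδ : δ ∈ ripSet A (4 * K)) (hδ1 : δ < 1) (hs : IsSparse K s)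
    {x : ℕ → Fin N → ℝ} (h : IsCoSaMP A (A *ᵥ s + e) K x) (l : ℕ) :
    l2norm (s - x (l + 1)) ≤ CoSaMP.C δ * l2norm (s - x l) + CoSaMP.C₁ δ * l2norm e := by
  obtain ⟨v, hv, hb⟩ := h.step l
  rw [residual_eq] at hv
  set r := s - x l with hr
  have hδ0 := hδ.1
  have hR : (supp s ∪ supp (x l)).card ≤ 2 * K :=
    (card_union_le_add hs (h.isSparse l)).trans (by omega)
  have hcard : (supp s ∪ (supp v ∪ supp (x l))).card ≤ 4 * K :=
    (card_union_le_add hs (card_union_le_add hv.1 (h.isSparse l))).trans (by omega)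
  have hrR : ∀ i ∉ supp s ∪ supp (x l), r i = 0 := sub_eq_zero_of_notMem_union subset_rfl
  have hident : l2norm (restr ((supp s ∪ supp (x l)) \ supp v) r) ≤
      2 * (δ * l2norm r + √(1 + δ) * l2norm e) := by
    refine l2norm_restr_le_of_gradient_le hδ hcard (Q := supp v \ (supp s ∪ supp (x l)))
      ?_ ?_ ?_ ?_ e (hv.l2norm_restr_sdiff_le hR)
    · intro i
      simp only [Finset.mem_sdiff, Finset.mem_union]
      tauto
    · intro i
      simp only [Finset.mem_sdiff, Finset.mem_union]
      tauto
    · intro i hi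
      refine hrR i fun h => hi ?_
      simp only [Finset.mem_union] at h ⊢
      tauto
    · exact fun i hi => hrR i (Finset.mem_sdiff.mp hi).2
  set T := supp v ∪ supp (x l) with hT
  -- Outside the merged set the old iterate vanishes, so s = r there.
  have hmiss : l2norm (restr (supp s \ T) s) ≤
      l2norm (restr ((supp s ∪ supp (x l)) \ supp v) r) := by
    refine l2norm_le_l2norm_of_abs_le fun i => ?_
    by_cases hi : i ∈ supp s \ T
    · have hi' := hi
      simp only [hT, Finset.mem_sdiff, Finset.mem_union, not_or] at hi'
      have : i ∈ (supp s ∪ supp (x l)) \ supp v := by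
        simp only [Finset.mem_sdiff, Finset.mem_union]
        tauto
      rw [restr_of_mem hi, restr_of_mem this]
      simp [hr, apply_eq_zero_of_notMem_supp hi'.2.2]
    · rw [restr_of_notMem hi, abs_zero]
      exact abs_nonneg _
  have hls := mul_l2norm_sub_lsOn_le (e := e) hδ hδ1 hcard
  set b := lsOn A T (A *ᵥ s + e)
  -- s is itself K-sparse, hence a competitor in the best approximation of b.
  have hprune : l2norm (s - x (l + 1)) ≤ 2 * l2norm (s - b) := by
    have h1 := hb.2 s hs
    have h2 := l2norm_add_le (s - b) (b - x (l + 1))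
    rw [sub_add_sub_cancel] at h2
    rw [l2norm_sub_comm b s] at h1
    linarith
  have hpos : 0 < 1 - δ := sub_pos.mpr hδ1
  have hE := l2norm_nonneg e
  have hρ := l2norm_nonneg r
  have hsqrt := mul_le_mul_of_nonneg_right (sqrt_one_add_le hδ0) hE
  have hmain : (1 - δ) * l2norm (s - x (l + 1)) ≤
      4 * δ * l2norm r + (6 + 3 * δ) * l2norm e := by
    have := mul_le_mul_of_nonneg_left hprune hpos.le
    linarith
  -- A second factor 1 − δ produces the stated denominator; (1 − δ)(6 + 3δ) = 6 − 3δ − 3δ² ≤ 6 + 2δ.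
  have hfin : (1 - δ) ^ 2 * l2norm (s - x (l + 1)) ≤
      4 * δ * l2norm r + (6 + 2 * δ) * l2norm e := by
    have := mul_le_mul_of_nonneg_left hmain hpos.le
    nlinarith [mul_nonneg (mul_nonneg hδ0 hδ0) hρ, mul_nonneg hδ0 hE,
      mul_nonneg (mul_nonneg hδ0 hδ0) hE]
  simp only [CoSaMP.C, CoSaMP.C₁]
  rw [div_mul_eq_mul_div, div_mul_eq_mul_div, ← add_div, le_div_iff₀ (pow_pos hpos 2)]
  linarith

/-- Write σ, σ' for the old and new missed parts of s, τ for the part missed by the merged set, η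
for the least squares error on that set, ρ = ‖r‖ and q = √(1+δ)‖e‖. The chain is (1−δ)ρ ≤ σ + q, τ ≤
2(δρ + q), (1−δ)η ≤ δτ + q, σ' ≤ τ + 2η. -/
theorem IsSP.step_le (hδ : δ ∈ ripSet A (3 * K)) (hδ1 : δ < 1) (hs : IsSparse K s)
    {T : ℕ → Finset (Fin N)} {x : ℕ → Fin N → ℝ} (h : IsSP A (A *ᵥ s + e) K T x) (l : ℕ) :
    l2norm (restr (supp s \ T (l + 1)) s) ≤
      SP.C δ * l2norm (restr (supp s \ T l) s) + SP.C₁ δ * l2norm e := by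
  obtain ⟨v, p, hv, hp, hT⟩ := h.step l
  rw [hT]
  have hTl := h.card_le l
  have hx := h.sol l
  have hδ0 := hδ.1
  have hpos : 0 < 1 - δ := sub_pos.mpr hδ1
  -- The current iterate is a least squares fit, so its gradient vanishes on `T l`. Removing `T l`
  -- from both sides of the later comparison thus costs nothing, and r vanishes on what remains of
  -- the falsely selected indices.
  have huT : ∀ i ∈ T l, (Aᵀ *ᵥ (A *ᵥ (s - x l) + e)) i = 0 := fun i hi => by
    rw [← residual_eq, hx]
    exact gradient_lsOn_eq_zero hi _
  rw [residual_eq] at hv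
  have hls := mul_l2norm_sub_lsOn_le (e := e) (s := s) (T := T l) hδ hδ1
    ((card_union_le_add hs hTl).trans (by omega))
  rw [← hx] at hls
  set r := s - x l with hr
  set u := Aᵀ *ᵥ (A *ᵥ r + e) with hu
  have hcard : (supp s ∪ (supp v ∪ T l)).card ≤ 3 * K :=
    (card_union_le_add hs (card_union_le_add hv.1 hTl)).trans (by omega)
  have hrST : ∀ i, i ∉ supp s → i ∉ T l → r i = 0 := fun i h1 h2 => by
    simp [hr, hx, apply_eq_zero_of_notMem_supp h1, lsOn_of_notMem h2]
  have hrestr : ∀ S : Finset (Fin N), restr (S \ T l) u = restr S u := fun S => by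
    funext i
    by_cases hi : i ∈ T l
    · simp [restr, hi, huT i hi]
    · simp [restr, hi]
  have hident : l2norm (restr ((supp s \ supp v) \ T l) r) ≤
      2 * (δ * l2norm r + √(1 + δ) * l2norm e) := by
    refine l2norm_restr_le_of_gradient_le hδ hcard (Q := (supp v \ supp s) \ T l)
      ?_ ?_ ?_ ?_ e ?_
    · intro i
      simp only [Finset.mem_sdiff, Finset.mem_union]
      tauto
    · intro i
      simp only [Finset.mem_sdiff, Finset.mem_union]
      tauto
    · intro i hi
      simp only [Finset.mem_union, not_or] at hi
      exact hrST i hi.1 hi.2.2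
    · intro i hi
      simp only [Finset.mem_sdiff] at hi
      exact hrST i hi.1.2 hi.2
    · rw [← hu, hrestr, hrestr]
      exact hv.l2norm_restr_sdiff_le hs
  set T' := supp v ∪ T l with hT'
  have hmiss : restr ((supp s \ supp v) \ T l) r = restr (supp s \ T') s := by
    funext i
    by_cases hi : i ∈ T l
    · simp [restr, hT', hi]
    · simp [restr, hT', hi, hr, hx, lsOn_of_notMem hi]
  rw [hmiss] at hident
  have hls' := mul_l2norm_restr_sub_lsOn_le (e := e) hδ hcard
  have hpT' : ∀ i ∉ T', lsOn A T' (A *ᵥ s + e) i = 0 := fun i hi => lsOn_of_notMem hi _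
  set b := lsOn A T' (A *ᵥ s + e)
  -- On the pruned indices of supp s, b is no larger than on the wrongly kept ones, where s = 0 and
  -- b = b − s. This costs one η; passing from b back to s costs the second.
  have hprune : l2norm (restr (supp s \ supp p) s) ≤
      l2norm (restr (supp s \ T') s) + 2 * l2norm (restr T' (s - b)) := by
    have h1 := hp.l2norm_restr_sdiff_le hs
    have h2 : l2norm (restr (supp p \ supp s) b) ≤ l2norm (restr T' (s - b)) := by
      refine l2norm_le_l2norm_of_abs_le fun i => ?_
      by_cases hi : i ∈ supp p \ supp s
      · rw [restr_of_mem hi]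
        by_cases hiT : i ∈ T'
        · simp [restr_of_mem hiT, apply_eq_zero_of_notMem_supp (Finset.mem_sdiff.mp hi).2]
        · simp [hpT' i hiT]
      · rw [restr_of_notMem hi, abs_zero]
        exact abs_nonneg _
    have h3 : restr (supp s \ supp p) s = restr (supp s \ supp p) b +
        (restr ((supp s \ supp p) ∩ T') (s - b) + restr ((supp s \ supp p) \ T') s) := by
      funext i
      by_cases hiT : i ∈ T'
      · by_cases hi : i ∈ supp s \ supp p
        · simp only [Pi.add_apply, restr, Finset.mem_inter, Finset.mem_sdiff (s := supp s \ supp p),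
            hiT, hi]
          simp
        · simp only [Pi.add_apply, restr, Finset.mem_inter, Finset.mem_sdiff (s := supp s \ supp p),
            hiT, hi]
          simp
      · by_cases hi : i ∈ supp s \ supp p
        · simp only [Pi.add_apply, restr, Finset.mem_inter, Finset.mem_sdiff (s := supp s \ supp p),
            hiT, hi, hpT' i hiT]
          simp
        · simp only [Pi.add_apply, restr, Finset.mem_inter, Finset.mem_sdiff (s := supp s \ supp p),
            hiT, hi]
          simp
    have h4 := l2norm_add_le (restr (supp s \ supp p) b)
      (restr ((supp s \ supp p) ∩ T') (s - b) + restr ((supp s \ supp p) \ T') s)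
    have h5 := l2norm_add_le (restr ((supp s \ supp p) ∩ T') (s - b))
      (restr ((supp s \ supp p) \ T') s)
    have h6 := l2norm_restr_mono (Finset.inter_subset_right (s₁ := supp s \ supp p) (s₂ := T'))
      (s - b)
    have h7 := l2norm_restr_mono
      (Finset.sdiff_subset_sdiff (Finset.sdiff_subset (s := supp s) (t := supp p))
        (subset_refl T')) s
    rw [← h3] at h4
    linarith
  have hE := l2norm_nonneg e
  have hσ := l2norm_nonneg (restr (supp s \ T l) s)
  generalize l2norm (restr (supp s \ supp p) s) = σ' at *
  generalize l2norm (restr (supp s \ T l) s) = σ at *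
  generalize l2norm (restr (supp s \ T') s) = τ at *
  generalize l2norm (restr T' (s - b)) = η at *
  generalize l2norm r = ρ at *
  generalize l2norm e = ε at *
  have hsq : √(1 + δ) * ε ≤ (1 + δ) * ε :=
    mul_le_mul_of_nonneg_right ((sqrt_one_add_le hδ0).trans (by linarith)) hE
  generalize √(1 + δ) * ε = q at *
  have hτ : (1 - δ) * τ ≤ 2 * δ * σ + 2 * q := by
    nlinarith [mul_le_mul_of_nonneg_left hident hpos.le, mul_le_mul_of_nonneg_left hls hδ0]
  have hσ' : (1 - δ) * σ' ≤ (1 + δ) * τ + 2 * q := by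
    nlinarith [mul_le_mul_of_nonneg_left hprune hpos.le]
  have hσ2 : (1 - δ) ^ 2 * σ' ≤ (1 + δ) * (2 * δ) * σ + 4 * q := by
    nlinarith [mul_le_mul_of_nonneg_left hσ' hpos.le,
      mul_le_mul_of_nonneg_left hτ (by linarith : 0 ≤ 1 + δ)]
  have hmain : σ' ≤ ((1 + δ) * (2 * δ) * σ + 4 * (1 + δ) * ε) / (1 - δ) ^ 2 := by
    rw [le_div_iff₀ (pow_pos hpos 2)]
    linarith
  -- The argument gives this smaller factor; the stated `SP.C` has one further 1 / (1 − δ) ≥ 1.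
  have hC : (1 + δ) * (2 * δ) / (1 - δ) ^ 2 ≤ SP.C δ := by
    rw [SP.C, div_le_div_iff₀ (pow_pos hpos 2) (pow_pos hpos 3),
      show (2 * δ + 2 * δ ^ 2) * (1 - δ) ^ 2 = (1 + δ) * (2 * δ) * ((1 - δ) ^ 2 * 1) by ring,
      show (1 - δ) ^ 3 = (1 - δ) ^ 2 * (1 - δ) by ring]
    exact mul_le_mul_of_nonneg_left
      (mul_le_mul_of_nonneg_left (by linarith) (sq_nonneg _))
      (mul_nonneg (by linarith) (by linarith))
  have hfin := mul_le_mul_of_nonneg_right hC hσ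
  rw [add_div] at hmain
  rw [SP.C₁]
  calc σ' ≤ _ := hmain
    _ = (1 + δ) * (2 * δ) / (1 - δ) ^ 2 * σ + 4 * (1 + δ) / (1 - δ) ^ 2 * ε := by ring
    _ ≤ _ := by linarith

/-! ### Contraction thresholds and accumulated error bounds -/

theorem CoSaMP.C_lt_one (h : δ ≤ 0.171) : CoSaMP.C δ < 1 := by
  norm_num at h
  -- The claim becomes 1 − 6δ + δ² > 0, with smaller root 3 − 2√2 ≈ 0.1716.
  rw [CoSaMP.C, div_lt_one (pow_pos (by linarith) 2)]
  nlinarith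

theorem SP.C_lt_one (h0 : 0 ≤ δ) (h : δ ≤ 0.206) : SP.C δ < 1 := by
  norm_num at h
  -- The claim becomes 1 − 5δ + δ² − δ³ > 0, whose only real root lies between 0.206 and 0.207.
  rw [SP.C, div_lt_one (pow_pos (by linarith) 3)]
  have h1 : δ ^ 2 ≤ 103 / 500 * δ := by nlinarith
  have h2 : δ ^ 3 ≤ (103 / 500) * δ ^ 2 := by nlinarith [sq_nonneg δ]
  nlinarith

theorem IHT.C_lt_one (h0 : 0 ≤ δ) (h : δ ≤ 0.353) : IHT.C δ < 1 := by
  norm_num at h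
  -- Sharp enough, since 2.83 · 0.353 = 0.99899.
  have h8 : √8 ≤ 2.83 := by
    rw [Real.sqrt_le_left (by norm_num)]
    norm_num
  norm_num at h8
  rw [IHT.C]
  nlinarith

theorem IsIHT.l2norm_sub_le (hδ : δ ∈ ripSet A (3 * K)) (hδ1 : δ ≤ 0.353) (hs : IsSparse K s)
    {x : ℕ → Fin N → ℝ} (h : IsIHT A (A *ᵥ s + e) K x) (l : ℕ) :
    l2norm (s - x l) ≤ IHT.C δ ^ l * l2norm s + IHT.D δ * l2norm e := by
  have hC₁ : 0 ≤ IHT.C₁ δ * l2norm e :=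
    mul_nonneg (mul_nonneg zero_le_two (Real.sqrt_nonneg _)) (l2norm_nonneg e)
  have := le_pow_mul_add_of_le_mul_add (f := fun l => l2norm (s - x l))
    (mul_nonneg (Real.sqrt_nonneg 8) hδ.1) (IHT.C_lt_one hδ.1 hδ1) hC₁ (h.step_le hδ hs) l
  simp only [h.init, sub_zero] at this
  refine this.trans_eq ?_
  rw [IHT.D, IHT.C₁, IHT.C]
  ring

theorem IsCoSaMP.l2norm_sub_le (hδ : δ ∈ ripSet A (4 * K)) (hδ1 : δ ≤ 0.171)
    (hs : IsSparse K s) {x : ℕ → Fin N → ℝ} (h : IsCoSaMP A (A *ᵥ s + e) K x) (l : ℕ) :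
    l2norm (s - x l) ≤ CoSaMP.C δ ^ l * l2norm s + CoSaMP.D δ * l2norm e := by
  have hδ0 := hδ.1
  have hlt : δ < 1 := hδ1.trans_lt (by norm_num)
  have hpos : 0 < 1 - δ := sub_pos.mpr hlt
  have hC1 := CoSaMP.C_lt_one hδ1
  have hC0 : 0 ≤ CoSaMP.C δ := div_nonneg (by linarith) (sq_nonneg _)
  have hC₁ : 0 ≤ CoSaMP.C₁ δ * l2norm e :=
    mul_nonneg (div_nonneg (by linarith) (sq_nonneg _)) (l2norm_nonneg e)
  have := le_pow_mul_add_of_le_mul_add (f := fun l => l2norm (s - x l))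
    hC0 hC1 hC₁ (h.step_le hδ hlt hs) l
  simp only [h.init, sub_zero] at this
  refine this.trans_eq ?_
  -- The denominator of D is (1 − δ)² − 4δ.
  have hD : CoSaMP.C₁ δ / (1 - CoSaMP.C δ) = CoSaMP.D δ := by
    have hne : (1 - δ) ^ 2 ≠ 0 := (pow_pos hpos 2).ne'
    rw [CoSaMP.C₁, CoSaMP.C, CoSaMP.D, one_sub_div hne, div_div_div_cancel_right₀ hne]
    ring
  rw [mul_div_right_comm, hD]

/-- The recursion controls only the missed part of s; the least squares bound on `T l` converts it
into the full error at the price of 1 / (1 − δ) and one extra noise term. -/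
theorem IsSP.l2norm_sub_le (hδ : δ ∈ ripSet A (3 * K)) (hδ1 : δ ≤ 0.206) (hs : IsSparse K s)
    {T : ℕ → Finset (Fin N)} {x : ℕ → Fin N → ℝ} (h : IsSP A (A *ᵥ s + e) K T x) (l : ℕ) :
    l2norm (s - x l) ≤ 1.26 * SP.C δ ^ l * l2norm s + SP.D δ * l2norm e := by
  have hδ0 := hδ.1
  have hlt : δ < 1 := hδ1.trans_lt (by norm_num)
  have hpos : 0 < 1 - δ := sub_pos.mpr hlt
  have hE := l2norm_nonneg e
  have hC1 := SP.C_lt_one hδ0 hδ1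
  have hC0 : 0 ≤ SP.C δ := div_nonneg (by positivity) (pow_pos hpos 3).le
  have hC₁ : 0 ≤ SP.C₁ δ * l2norm e :=
    mul_nonneg (div_nonneg (by linarith) (sq_nonneg _)) hE
  have hiter := le_pow_mul_add_of_le_mul_add (f := fun l => l2norm (restr (supp s \ T l) s))
    hC0 hC1 hC₁ (h.step_le hδ hlt hs) l
  -- At the start, the missed part of s is bounded trivially by ‖s‖.
  have hinit := mul_le_mul_of_nonneg_left (l2norm_restr_le (supp s \ T 0) s) (pow_nonneg hC0 l)
  have hls := mul_l2norm_sub_lsOn_le (e := e) (s := s) (T := T l) hδ hlt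
    ((card_union_le_add hs (h.card_le l)).trans (by omega))
  rw [← h.sol l] at hls
  have hsq : √(1 + δ) * l2norm e ≤ (1 + δ) * l2norm e :=
    mul_le_mul_of_nonneg_right ((sqrt_one_add_le hδ0).trans (by linarith)) hE
  -- D is the limit noise C₁ / (1 − C) plus 1 + δ ≥ √(1+δ) from the final least squares bound, all
  -- over 1 − δ.
  have hD : (SP.C₁ δ / (1 - SP.C δ) + (1 + δ)) / (1 - δ) = SP.D δ := by
    have hne : (1 - δ) ^ 3 ≠ 0 := (pow_pos hpos 3).ne'
    have hne1 : 1 - δ ≠ 0 := hpos.ne'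
    have hden : (1 - δ) ^ 3 - (2 * δ + 2 * δ ^ 2) ≠ 0 := by
      rw [SP.C, div_lt_one (pow_pos hpos 3)] at hC1
      linarith
    have hden' : 1 - 6 * δ + 6 * δ ^ 2 - 2 * δ ^ 3 + δ ^ 4 =
        (1 - δ) * ((1 - δ) ^ 3 - (2 * δ + 2 * δ ^ 2)) := by ring
    rw [SP.C₁, SP.C, SP.D, hden', one_sub_div hne,
      show 4 * (1 + δ) / (1 - δ) ^ 2 = 4 * (1 + δ) * (1 - δ) / (1 - δ) ^ 3 by
        field_simp,
      div_div_div_cancel_right₀ hne, div_add' _ _ _ hden, div_div,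
      mul_comm (1 - δ) ((1 - δ) ^ 3 - _)]
    congr 1
    ring
  -- Origin of a = 1.26: 1 / (1 − 0.206) ≈ 1.2594.
  have hinv : (1 - δ)⁻¹ ≤ 1.26 := by
    rw [inv_le_comm₀ hpos (by norm_num)]
    norm_num at hδ1 ⊢
    linarith
  have hs0 : 0 ≤ SP.C δ ^ l * l2norm s := mul_nonneg (pow_nonneg hC0 l) (l2norm_nonneg s)
  have hmain : l2norm (s - x l) ≤
      (SP.C δ ^ l * l2norm s + (SP.C₁ δ / (1 - SP.C δ) + (1 + δ)) * l2norm e) / (1 - δ) := by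
    rw [le_div_iff₀ hpos]
    rw [mul_div_right_comm] at hiter
    linarith
  rw [add_div, mul_div_right_comm _ (l2norm e), hD, div_eq_inv_mul] at hmain
  have := mul_le_mul_of_nonneg_right hinv hs0
  linarith

end Algorithms

end GreedyPursuit

theorem theorem1 (M N K : ℕ) (A : Matrix (Fin M) (Fin N) ℝ) (s : Fin N → ℝ) (e : Fin M → ℝ)
    (hs : GreedyPursuit.IsSparse K s) :
    -- CoSaMP
    ((GreedyPursuit.ric A (4 * K) < 1 →
        ∀ x : ℕ → Fin N → ℝ, GreedyPursuit.IsCoSaMP A (A.mulVec s + e) K x →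
          ∀ l : ℕ, 1 ≤ l → GreedyPursuit.l2norm (s - x l) ≤
            GreedyPursuit.CoSaMP.C (GreedyPursuit.ric A (4 * K)) *
                GreedyPursuit.l2norm (s - x (l - 1)) +
              GreedyPursuit.CoSaMP.C₁ (GreedyPursuit.ric A (4 * K)) * GreedyPursuit.l2norm e) ∧
      (GreedyPursuit.ric A (4 * K) ≤ 0.171 →
        GreedyPursuit.CoSaMP.C (GreedyPursuit.ric A (4 * K)) < 1 ∧
        ∀ x : ℕ → Fin N → ℝ, GreedyPursuit.IsCoSaMP A (A.mulVec s + e) K x →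
          ∀ l : ℕ, GreedyPursuit.l2norm (s - x l) ≤
            1 * GreedyPursuit.CoSaMP.C (GreedyPursuit.ric A (4 * K)) ^ l *
                GreedyPursuit.l2norm s +
              GreedyPursuit.CoSaMP.D (GreedyPursuit.ric A (4 * K)) * GreedyPursuit.l2norm e)) ∧
    -- SP
    ((GreedyPursuit.ric A (3 * K) < 1 →
        ∀ (T : ℕ → Finset (Fin N)) (x : ℕ → Fin N → ℝ),
          GreedyPursuit.IsSP A (A.mulVec s + e) K T x →
          ∀ l : ℕ, 1 ≤ l →
            GreedyPursuit.l2norm (GreedyPursuit.subvec (GreedyPursuit.supp s \ T l) s) ≤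
            GreedyPursuit.SP.C (GreedyPursuit.ric A (3 * K)) *
                GreedyPursuit.l2norm
                  (GreedyPursuit.subvec (GreedyPursuit.supp s \ T (l - 1)) s) +
              GreedyPursuit.SP.C₁ (GreedyPursuit.ric A (3 * K)) * GreedyPursuit.l2norm e) ∧
      (GreedyPursuit.ric A (3 * K) ≤ 0.206 →
        GreedyPursuit.SP.C (GreedyPursuit.ric A (3 * K)) < 1 ∧
        ∀ (T : ℕ → Finset (Fin N)) (x : ℕ → Fin N → ℝ),
          GreedyPursuit.IsSP A (A.mulVec s + e) K T x →
          ∀ l : ℕ, GreedyPursuit.l2norm (s - x l) ≤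
            1.26 * GreedyPursuit.SP.C (GreedyPursuit.ric A (3 * K)) ^ l *
                GreedyPursuit.l2norm s +
              GreedyPursuit.SP.D (GreedyPursuit.ric A (3 * K)) * GreedyPursuit.l2norm e)) ∧
    -- IHT
    ((∀ x : ℕ → Fin N → ℝ, GreedyPursuit.IsIHT A (A.mulVec s + e) K x →
          ∀ l : ℕ, 1 ≤ l → GreedyPursuit.l2norm (s - x l) ≤
            GreedyPursuit.IHT.C (GreedyPursuit.ric A (3 * K)) *
                GreedyPursuit.l2norm (s - x (l - 1)) +
              GreedyPursuit.IHT.C₁ (GreedyPursuit.ric A (3 * K)) * GreedyPursuit.l2norm e) ∧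
      (GreedyPursuit.ric A (3 * K) ≤ 0.353 →
        GreedyPursuit.IHT.C (GreedyPursuit.ric A (3 * K)) < 1 ∧
        ∀ x : ℕ → Fin N → ℝ, GreedyPursuit.IsIHT A (A.mulVec s + e) K x →
          ∀ l : ℕ, GreedyPursuit.l2norm (s - x l) ≤
            1 * GreedyPursuit.IHT.C (GreedyPursuit.ric A (3 * K)) ^ l *
                GreedyPursuit.l2norm s +
              GreedyPursuit.IHT.D (GreedyPursuit.ric A (3 * K)) * GreedyPursuit.l2norm e)) := by
  -- The infimum is attained, so the isometry constant is itself admissible in the lemmas above.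
  have h3 := (GreedyPursuit.ric_isLeast A (3 * K)).1
  have h4 := (GreedyPursuit.ric_isLeast A (4 * K)).1
  refine ⟨⟨fun h x hx l hl => ?_, fun h => ⟨GreedyPursuit.CoSaMP.C_lt_one h,
      fun x hx l => ?_⟩⟩,
    ⟨fun h T x hx l hl => ?_, fun h => ⟨GreedyPursuit.SP.C_lt_one h3.1 h,
      fun T x hx l => hx.l2norm_sub_le h3 h hs l⟩⟩,
    ⟨fun x hx l hl => ?_, fun h => ⟨GreedyPursuit.IHT.C_lt_one h3.1 h, fun x hx l => ?_⟩⟩⟩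
  · obtain ⟨l, rfl⟩ := Nat.exists_eq_add_of_le' hl
    exact hx.step_le h4 h hs l
  · rw [one_mul]
    exact hx.l2norm_sub_le h4 h hs l
  · obtain ⟨l, rfl⟩ := Nat.exists_eq_add_of_le' hl
    rw [GreedyPursuit.l2norm_subvec, GreedyPursuit.l2norm_subvec]
    exact hx.step_le h3 h hs l
  · obtain ⟨l, rfl⟩ := Nat.exists_eq_add_of_le' hl
    exact hx.step_le h3 hs l
  · rw [one_mul]
    exact hx.l2norm_sub_le h3 h hs l
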